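/- Let $\chi$ be a discrete probability distribution with finite support $A$, let $P_\chi$ be its probability mass function, and let $\operatorname{H}(\chi) = -\sum_{x\in A} P_\chi(x)\log_2 P_\chi(x)$ be its Shannon entropy. For an integer $n \ge 1$ let $\chi^n$ be the $n$-fold product distribution, $P_{\chi^n}(a) = \prod_{i=1}^n P_\chi(a_i)$, and for $\delta \ge 0$ define the core set $$\mathcal{C}_{\chi}^{n,\delta} := \left\{ a \in A^n \;\middle|\; P_{\chi^n}(a) \geq 2^{-\operatorname{H}(\chi)n-\delta n} \right\}.$$ 1. There is a constant $K \ge 0$, depending only on $\chi$, such that for every $\delta \ge 0$ and every $n \ge 1$, $$\Pr_{k \leftarrow \chi^n}\left[ k \in \mathcal{C}_{\chi}^{n,\delta} \right] \;\geq\; \frac12 - K\, n^{-1/2}.$$ 2. There are constants $c_1, c_2 > 0$, depending only on $\chi$, such that for every $\varepsilon \in (0,1)$ and every $n \ge 1$ there exists $\delta \geq 0$ with $$c_1 \sqrt{\frac{\ln(\varepsilon^{-1})}{n}} \;\le\; \delta \;\le\; c_2 \sqrt{\frac{\ln(\varepsilon^{-1})}{n}} \qquad\text{and}\qquad \Pr_{k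 \leftarrow \chi^n}\left[ k \in \mathcal{C}_{\chi}^{n,\delta} \right] \geq 1-\varepsilon .$$ -/

import Mathlib

/-- The probability mass function `a ↦ ∏ i, χ (a i)` on `αⁿ` has total mass one. -/
theorem tsum_prod_pmf {α : Type*} (χ : PMF α) (n : ℕ) :
    ∑' a : Fin n → α, ∏ i, χ (a i) = 1 := by
  induction n with
  | zero => simp
  | succ n ih =>
    rw [← (Fin.consEquiv (fun _ : Fin (n + 1) => α)).tsum_eq, ENNReal.tsum_prod']
    simp [Fin.consEquiv, Fin.prod_univ_succ, ENNReal.tsum_mul_left, ih]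

/-- The `n`-fold product distribution `χⁿ` of a discrete probability distribution `χ`. -/
noncomputable def prodDist {α : Type*} (χ : PMF α) (n : ℕ) : PMF (Fin n → α) :=
  ⟨fun a => ∏ i, χ (a i), by
    rw [← tsum_prod_pmf χ n]
    exact ENNReal.summable.hasSum⟩

/-- The Shannon entropy (in bits) of a discrete probability distribution, summed over the support. -/
noncomputable def shannonEntropy {α : Type*} (χ : PMF α) : ℝ :=
  -∑' x : χ.support, (χ x).toReal * Real.logb 2 (χ x).toReal

/-- The probability `Pr_{k ← D}[k ∈ S]`. -/
noncomputable def prob {β : Type*} (D : PMF β) (S : Set β) : ℝ :=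
  (D.toOuterMeasure S).toReal

/-- The core set of `χ` with parameters `n` and `δ`: the tuples `a` of elements of the support
of `χ` such that `P_{χⁿ}(a) ≥ 2 ^ (-H(χ) n - δ n)`. -/
def coreSet {α : Type*} (χ : PMF α) (n : ℕ) (δ : ℝ) : Set (Fin n → α) :=
  {a | (∀ i, a i ∈ χ.support) ∧
    (2 : ℝ) ^ (-(shannonEntropy χ) * (n : ℝ) - δ * (n : ℝ)) ≤ (prodDist χ n a).toReal}

/-! Let X be the self-information −log₂ P_χ minus the entropy (`centredInfo`), which has mean zero
and is bounded on the finite support. A tuple of support elements lies in the core set as soon as S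
= ∑ X(aᵢ) is at most δn, so both claims are lower bounds for Pr[S ≤ δn].

The second claim is Hoeffding's inequality (`one_sub_exp_le_prodExpect`), with δ chosen so that the
tail bound equals ε.

For the first it suffices that E sign(S) ≤ K n^(-1/2), a one-sided Berry–Esseen bound
(`exists_prodExpect_sign_le`). A positive multiple of sign is majorised by `signKernel + B *
bumpKernel` (`exists_sign_le_kernel`), whose two terms are mixtures of sin(tx)/t and of cos(tx) over
0 ≤ t ≤ 1. Their expectations are therefore integrals of Im φ(t)ⁿ/t and Re φ(t)ⁿ, φ being the
characteristic function of X. Once X is scaled to |X| ≤ 1, |φ| has Gaussian decay on all of [0,1]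
and Im φ is O(t³), so each integral is O(n^(-1/2)). Frequencies above 1 never enter, hence lattice
distributions need no separate treatment. -/

open Set Filter MeasureTheory

/-! ### Band-limited majorant of the sign function -/

/-- A weakened form of the Cusa–Huygens inequality, cleared of denominators. -/
theorem three_mul_sin_le {x : ℝ} (hx : 0 ≤ x) :
    3 * Real.sin x ≤ 2 * x + x * Real.cos x := by
  rcases le_total x Real.pi with hpi | hpi
  -- Three differentiations of 2y + y cos y − 3 sin y lead to y sin y ≥ 0 on [0, π]; each
  -- intermediate function vanishes at 0, so nonnegativity lifts back.
  · have mono : ∀ f f' : ℝ → ℝ, (∀ y, HasDerivAt f (f' y) y) →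
        (∀ y, 0 ≤ y → y ≤ Real.pi → 0 ≤ f' y) → f 0 = 0 →
        ∀ y, 0 ≤ y → y ≤ Real.pi → 0 ≤ f y := by
      intro f f' hf hf' h0 y hy hy'
      have hm : MonotoneOn f (Icc 0 Real.pi) := by
        refine monotoneOn_of_hasDerivWithinAt_nonneg (convex_Icc _ _)
          (fun z _ => (hf z).continuousAt.continuousWithinAt)
          (fun z _ => (hf z).hasDerivWithinAt) ?_
        intro z hz
        rw [interior_Icc] at hz
        exact hf' z hz.1.le hz.2.le
      have := hm ⟨le_rfl, Real.pi_pos.le⟩ ⟨hy, hy'⟩ hy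
      rwa [h0] at this
    have h2 : ∀ y, 0 ≤ y → y ≤ Real.pi → 0 ≤ Real.sin y - y * Real.cos y := by
      refine mono _ (fun y => y * Real.sin y) (fun y => ?_)
        (fun y h0 h1 => mul_nonneg h0 (Real.sin_nonneg_of_nonneg_of_le_pi h0 h1)) (by simp)
      have := (Real.hasDerivAt_sin y).sub ((hasDerivAt_id y).mul (Real.hasDerivAt_cos y))
      refine this.congr_deriv ?_
      simp
    have h1 : ∀ y, 0 ≤ y → y ≤ Real.pi → 0 ≤ 2 - 2 * Real.cos y - y * Real.sin y := by
      refine mono _ _ (fun y => ?_) h2 (by simp)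
      have := (((Real.hasDerivAt_cos y).const_mul 2).const_sub 2).sub
        ((hasDerivAt_id y).mul (Real.hasDerivAt_sin y))
      refine this.congr_deriv ?_
      simp; ring
    have h0 : ∀ y, 0 ≤ y → y ≤ Real.pi → 0 ≤ 2 * y + y * Real.cos y - 3 * Real.sin y := by
      refine mono _ _ (fun y => ?_) h1 (by simp)
      have := (((hasDerivAt_id y).const_mul 2).add
        ((hasDerivAt_id y).mul (Real.hasDerivAt_cos y))).sub
        ((Real.hasDerivAt_sin y).const_mul 3)
      refine this.congr_deriv ?_
      simp; ring
    linarith [h0 x hx hpi]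
  · have h1 := Real.sin_le_one x
    have h2 := Real.neg_one_le_cos x
    nlinarith [Real.pi_gt_three]

/-- A nonnegative band-limited function, used as error term. -/
noncomputable def bumpKernel (x : ℝ) : ℝ := ∫ t in (0 : ℝ)..1, (1 - t) ^ 2 * Real.cos (t * x)

/-- A band-limited approximation of a multiple of the sign function. -/
noncomputable def signKernel (x : ℝ) : ℝ :=
  ∫ t in (0 : ℝ)..1, (1 - t) ^ 3 * (1 + 3 * t) * (Real.sin (t * x) / t)

theorem abs_sin_mul_div_le (t x : ℝ) : |Real.sin (t * x) / t| ≤ |x| := by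
  rcases eq_or_ne t 0 with rfl | ht
  · simp
  · rw [abs_div, div_le_iff₀ (abs_pos.2 ht), ← abs_mul, mul_comm x t]
    exact Real.abs_sin_le_abs

theorem intervalIntegrable_signKernel (x : ℝ) : IntervalIntegrable
    (fun t => (1 - t) ^ 3 * (1 + 3 * t) * (Real.sin (t * x) / t)) volume 0 1 := by
  have h : IntervalIntegrable (fun t : ℝ => Real.sin (t * x) / t) volume 0 1 := by
    refine (intervalIntegrable_const (c := |x|)).mono_fun' ?_ ?_
    · exact (Measurable.aestronglyMeasurable (by fun_prop))
    · exact Eventually.of_forall fun t => abs_sin_mul_div_le t x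
  exact h.continuousOn_mul (by fun_prop)

theorem hasDerivAt_bumpKernel (x : ℝ) :
    HasDerivAt bumpKernel (-∫ t in (0 : ℝ)..1, t * (1 - t) ^ 2 * Real.sin (t * x)) x := by
  have := (intervalIntegral.hasDerivAt_integral_of_dominated_loc_of_deriv_le
    (μ := volume) (a := 0) (b := 1) (bound := fun _ => 1) (x₀ := x) (s := univ)
    (F := fun x t => (1 - t) ^ 2 * Real.cos (t * x))
    (F' := fun x t => -(t * (1 - t) ^ 2 * Real.sin (t * x))) univ_mem
    (Eventually.of_forall fun y => (by fun_prop : Continuous _).aestronglyMeasurable)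
    ((by fun_prop : Continuous _).intervalIntegrable _ _)
    ((by fun_prop : Continuous _).aestronglyMeasurable) ?_ intervalIntegrable_const ?_).2
  · rwa [intervalIntegral.integral_neg] at this
  · refine Eventually.of_forall fun t ht y _ => ?_
    rw [uIoc_of_le zero_le_one] at ht
    rw [norm_neg, norm_mul, Real.norm_eq_abs, Real.norm_eq_abs,
      abs_of_nonneg (mul_nonneg ht.1.le (sq_nonneg _))]
    refine mul_le_one₀ ?_ (abs_nonneg _) (Real.abs_sin_le_one _)
    nlinarith [ht.1, ht.2, mul_nonneg ht.1.le (sub_nonneg.2 ht.2)]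
  · refine Eventually.of_forall fun t _ y _ => ?_
    have := (((hasDerivAt_id y).const_mul t).cos).const_mul ((1 - t) ^ 2)
    refine this.congr_deriv ?_
    simp; ring

theorem hasDerivAt_signKernel (x : ℝ) :
    HasDerivAt signKernel
      (∫ t in (0 : ℝ)..1, (1 - t) ^ 3 * (1 + 3 * t) * Real.cos (t * x)) x := by
  refine (intervalIntegral.hasDerivAt_integral_of_dominated_loc_of_deriv_le
    (μ := volume) (a := 0) (b := 1) (bound := fun _ => 4) (x₀ := x) (s := univ)
    (F := fun x t => (1 - t) ^ 3 * (1 + 3 * t) * (Real.sin (t * x) / t))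
    (F' := fun x t => (1 - t) ^ 3 * (1 + 3 * t) * Real.cos (t * x)) univ_mem
    (Eventually.of_forall fun y => (by fun_prop : Measurable _).aestronglyMeasurable)
    (intervalIntegrable_signKernel x)
    ((by fun_prop : Continuous _).aestronglyMeasurable) ?_ intervalIntegrable_const ?_).2
  · refine Eventually.of_forall fun t ht y _ => ?_
    rw [uIoc_of_le zero_le_one] at ht
    have h1 : (1 - t) ^ 3 ≤ 1 := pow_le_one₀ (by linarith [ht.2]) (by linarith [ht.1])
    have h0 : 0 ≤ (1 - t) ^ 3 := pow_nonneg (by linarith [ht.2]) _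
    rw [norm_mul, Real.norm_eq_abs, Real.norm_eq_abs,
      abs_of_nonneg (mul_nonneg h0 (by linarith [ht.1]))]
    have h2 : (1 - t) ^ 3 * (1 + 3 * t) ≤ 4 := by nlinarith [ht.1, ht.2]
    nlinarith [Real.abs_cos_le_one (t * y), abs_nonneg (Real.cos (t * y)), ht.1]
  · refine Eventually.of_forall fun t ht y _ => ?_
    rw [uIoc_of_le zero_le_one] at ht
    have := ((((hasDerivAt_id y).const_mul t).sin).div_const t).const_mul
      ((1 - t) ^ 3 * (1 + 3 * t))
    refine this.congr_deriv ?_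
    have := ht.1.ne'
    simp only [id]
    field_simp

/-- Integration by parts: the weight (1−t)³(1+3t) has derivative −12t(1−t)², and the boundary terms
vanish. Hence x·`signKernel`′ = −12·`bumpKernel`′, the relation that ties the two kernels together.
-/
theorem mul_deriv_signKernel (x : ℝ) :
    x * (∫ t in (0 : ℝ)..1, (1 - t) ^ 3 * (1 + 3 * t) * Real.cos (t * x)) =
      12 * ∫ t in (0 : ℝ)..1, t * (1 - t) ^ 2 * Real.sin (t * x) := by
  have h := intervalIntegral.integral_eq_sub_of_hasDerivAt (a := 0) (b := 1)
    (f := fun t : ℝ => (1 - t) ^ 3 * (1 + 3 * t) * Real.sin (t * x))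
    (f' := fun t => x * ((1 - t) ^ 3 * (1 + 3 * t) * Real.cos (t * x)) -
      12 * (t * (1 - t) ^ 2 * Real.sin (t * x))) (fun t _ => ?_)
    ((by fun_prop : Continuous _).intervalIntegrable _ _)
  · rw [intervalIntegral.integral_sub ((by fun_prop : Continuous _).intervalIntegrable _ _)
      ((by fun_prop : Continuous _).intervalIntegrable _ _),
      intervalIntegral.integral_const_mul, intervalIntegral.integral_const_mul] at h
    simp at h
    linarith
  · have := ((((hasDerivAt_id t).const_sub 1).pow 3).mul
      (((hasDerivAt_id t).const_mul 3).const_add 1)).mul ((hasDerivAt_id t).mul_const x).sin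
    refine this.congr_deriv ?_
    simp; ring

/-- An explicit antiderivative evaluates the integral to (2/x⁴)(2x + x cos x − 3 sin x), to which
`three_mul_sin_le` applies. -/
theorem integral_mul_sin_nonneg {x : ℝ} (hx : 0 < x) :
    0 ≤ ∫ t in (0 : ℝ)..1, t * (1 - t) ^ 2 * Real.sin (t * x) := by
  have h := intervalIntegral.integral_eq_sub_of_hasDerivAt (a := 0) (b := 1)
    (f := fun t : ℝ => -(t * (1 - t) ^ 2) / x * Real.cos (t * x)
      + (1 - 4 * t + 3 * t ^ 2) / x ^ 2 * Real.sin (t * x)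
      + (-4 + 6 * t) / x ^ 3 * Real.cos (t * x) - 6 / x ^ 4 * Real.sin (t * x))
    (f' := fun t => t * (1 - t) ^ 2 * Real.sin (t * x)) (fun t _ => ?_)
    ((by fun_prop : Continuous _).intervalIntegrable _ _)
  · rw [h]
    have e : (2 * x + x * Real.cos x - 3 * Real.sin x) * (2 / x ^ 4) =
        2 / x ^ 3 * Real.cos x - 6 / x ^ 4 * Real.sin x + 4 / x ^ 3 := by
      field_simp; ring
    have : 0 ≤ (2 * x + x * Real.cos x - 3 * Real.sin x) * (2 / x ^ 4) :=
      mul_nonneg (by linarith [three_mul_sin_le hx.le]) (by positivity)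
    rw [e] at this
    norm_num
    rw [neg_div]
    linarith
  · have hs := ((hasDerivAt_id t).mul_const x).sin
    have hc := ((hasDerivAt_id t).mul_const x).cos
    have h1 := (((hasDerivAt_id t).mul (((hasDerivAt_id t).const_sub 1).pow 2)).neg.div_const
      x).mul hc
    have h2 := (((((hasDerivAt_id t).const_mul 4).const_sub 1).add
      (((hasDerivAt_id t).pow 2).const_mul 3)).div_const (x ^ 2)).mul hs
    have h3 := ((((hasDerivAt_id t).const_mul 6).const_add (-4)).div_const (x ^ 3)).mul hc
    have h4 := hs.const_mul (6 / x ^ 4)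
    refine (((h1.add h2).add h3).sub h4).congr_deriv ?_
    simp
    field_simp
    ring

theorem deriv_signKernel_nonneg {x : ℝ} (hx : 0 < x) :
    0 ≤ ∫ t in (0 : ℝ)..1, (1 - t) ^ 3 * (1 + 3 * t) * Real.cos (t * x) := by
  have h := mul_deriv_signKernel x
  have h1 := integral_mul_sin_nonneg hx
  exact nonneg_of_mul_nonneg_right (by linarith : 0 ≤ x * _) hx

theorem signKernel_zero : signKernel 0 = 0 := by simp [signKernel]

theorem signKernel_neg (x : ℝ) : signKernel (-x) = -signKernel x := by
  simp [signKernel, neg_div]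

theorem monotoneOn_signKernel : MonotoneOn signKernel (Ici 0) := by
  refine monotoneOn_of_hasDerivWithinAt_nonneg (convex_Ici _)
    (fun z _ => (hasDerivAt_signKernel z).continuousAt.continuousWithinAt)
    (fun z _ => (hasDerivAt_signKernel z).hasDerivWithinAt) ?_
  intro z hz
  rw [interior_Ici] at hz
  exact deriv_signKernel_nonneg hz

theorem antitoneOn_bumpKernel : AntitoneOn bumpKernel (Ici 0) := by
  refine antitoneOn_of_hasDerivWithinAt_nonpos (convex_Ici _)
    (fun z _ => (hasDerivAt_bumpKernel z).continuousAt.continuousWithinAt)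
    (fun z _ => (hasDerivAt_bumpKernel z).hasDerivWithinAt) ?_
  intro z hz
  rw [interior_Ici] at hz
  linarith [integral_mul_sin_nonneg hz]

/-- By `mul_deriv_signKernel` the derivative is (1 − x)·`signKernel`′(x). -/
theorem antitoneOn_signKernel_add_bumpKernel :
    AntitoneOn (fun x => signKernel x + 12 * bumpKernel x) (Ici 1) := by
  have hd := fun z => (hasDerivAt_signKernel z).add ((hasDerivAt_bumpKernel z).const_mul 12)
  refine antitoneOn_of_hasDerivWithinAt_nonpos (convex_Ici _)
    (fun z _ => (hd z).continuousAt.continuousWithinAt)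
    (fun z _ => (hd z).hasDerivWithinAt) ?_
  intro z hz
  rw [interior_Ici, mem_Ioi] at hz
  have h1 := mul_deriv_signKernel z
  have h2 := deriv_signKernel_nonneg (zero_lt_one.trans hz)
  nlinarith

theorem bumpKernel_neg (x : ℝ) : bumpKernel (-x) = bumpKernel x := by simp [bumpKernel]

theorem bumpKernel_eq {x : ℝ} (hx : 0 < x) :
    bumpKernel x = 2 / x ^ 3 * (x - Real.sin x) := by
  have h := intervalIntegral.integral_eq_sub_of_hasDerivAt (a := 0) (b := 1)
    (f := fun t : ℝ => (1 - t) ^ 2 / x * Real.sin (t * x)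
      - 2 * (1 - t) / x ^ 2 * Real.cos (t * x) - 2 / x ^ 3 * Real.sin (t * x))
    (f' := fun t => (1 - t) ^ 2 * Real.cos (t * x)) (fun t _ => ?_)
    ((by fun_prop : Continuous _).intervalIntegrable _ _)
  · rw [bumpKernel, h]
    norm_num
    field_simp
    ring
  · have hs := ((hasDerivAt_id t).mul_const x).sin
    have hc := ((hasDerivAt_id t).mul_const x).cos
    have h1 := ((((hasDerivAt_id t).const_sub 1).pow 2).div_const x).mul hs
    have h2 := ((((hasDerivAt_id t).const_sub 1).const_mul 2).div_const (x ^ 2)).mul hc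
    have h3 := hs.const_mul (2 / x ^ 3)
    refine ((h1.sub h2).sub h3).congr_deriv ?_
    simp
    field_simp
    ring

theorem bumpKernel_pos {x : ℝ} (hx : 0 < x) : 0 < bumpKernel x := by
  rw [bumpKernel_eq hx]
  exact mul_pos (by positivity) (sub_pos.2 (Real.sin_lt hx))

theorem bumpKernel_nonneg (x : ℝ) : 0 ≤ bumpKernel x := by
  rcases lt_trichotomy x 0 with h | rfl | h
  · rw [← bumpKernel_neg]; exact (bumpKernel_pos (neg_pos.2 h)).le
  · exact (bumpKernel_pos one_pos).le.trans
      (antitoneOn_bumpKernel (mem_Ici.2 le_rfl) (mem_Ici.2 zero_le_one) zero_le_one)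
  · exact (bumpKernel_pos h).le

theorem signKernel_one_pos : 0 < signKernel 1 := by
  refine intervalIntegral.intervalIntegral_pos_of_pos_on (intervalIntegrable_signKernel 1) ?_
    one_pos
  intro t ht
  have : 0 < Real.sin (t * 1) := Real.sin_pos_of_pos_of_lt_pi (by linarith [ht.1])
    (by linarith [ht.2, Real.pi_gt_three])
  have h1 : 0 < 1 - t := by linarith [ht.2]
  have h2 := ht.1
  positivity

/-- The sign function is dominated by a band-limited function. -/
theorem exists_sign_le_kernel : ∃ L B : ℝ, 0 < L ∧ 0 ≤ B ∧
    ∀ x, L * (SignType.sign x : ℝ) ≤ signKernel x + B * bumpKernel x := by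
  -- Passing through max x y replaces any computation of limits at infinity.
  have hb : ∀ x y, 1 ≤ x → 0 ≤ y → signKernel y ≤ signKernel x + 12 * bumpKernel x := by
    intro x y hx hy
    have h1 := antitoneOn_signKernel_add_bumpKernel (mem_Ici.2 hx)
      (mem_Ici.2 (hx.trans (le_max_left x y))) (le_max_left x y)
    have h2 := monotoneOn_signKernel (mem_Ici.2 hy)
      (mem_Ici.2 (hy.trans (le_max_right x y))) (le_max_right x y)
    have h3 := bumpKernel_nonneg (max x y)
    simp only at h1
    linarith
  obtain ⟨L, hL⟩ : ∃ L, IsLUB (signKernel '' Ici 0) L :=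
    Real.exists_isLUB ⟨_, 0, mem_Ici.2 le_rfl, rfl⟩
      ⟨signKernel 1 + 12 * bumpKernel 1, by rintro _ ⟨y, hy, rfl⟩; exact hb 1 y le_rfl hy⟩
  have hle : ∀ y, 0 ≤ y → signKernel y ≤ L := fun y hy => hL.1 ⟨y, hy, rfl⟩
  have hL0 : 0 < L := signKernel_one_pos.trans_le (hle 1 zero_le_one)
  have hW := bumpKernel_pos one_pos
  -- The summand 12 serves x ≥ 1; the summand L / `bumpKernel 1` serves 0 < x ≤ 1, where `bumpKernel
  -- x` ≥ `bumpKernel 1`.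
  refine ⟨L, 12 + L / bumpKernel 1, hL0, by positivity, fun x => ?_⟩
  have hWx := bumpKernel_nonneg x
  have hq : 0 ≤ L / bumpKernel 1 := by positivity
  rcases lt_trichotomy x 0 with h | rfl | h
  · have h1 := hle (-x) (by linarith)
    rw [signKernel_neg] at h1
    rw [sign_neg h]
    simp only [SignType.coe_neg, SignType.coe_one]
    nlinarith
  · rw [signKernel_zero]; simp; positivity
  · rw [sign_pos h]
    simp only [SignType.coe_one, mul_one]
    rcases le_total 1 x with h1 | h1
    · have : L ≤ signKernel x + 12 * bumpKernel x :=
        hL.2 (by rintro _ ⟨y, hy, rfl⟩; exact hb x y h1 hy)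
      nlinarith
    · have h2 := antitoneOn_bumpKernel (mem_Ici.2 h.le) (mem_Ici.2 zero_le_one) h1
      have h3 := monotoneOn_signKernel (mem_Ici.2 le_rfl) (mem_Ici.2 h.le) h.le
      rw [signKernel_zero] at h3
      have h4 : L / bumpKernel 1 * bumpKernel 1 = L := div_mul_cancel₀ _ hW.ne'
      nlinarith [mul_le_mul_of_nonneg_left h2 hq]

/-! ### Product expectations and the characteristic function -/

/-- The expectation of `f` under the `n`-fold product of the weights `p` on the finite set `s`. -/
noncomputable def prodExpect {α : Type*} (s : Finset α) (p : α → ℝ) (n : ℕ)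
    (f : (Fin n → α) → ℝ) : ℝ :=
  ∑ a ∈ Fintype.piFinset fun _ : Fin n => s, (∏ i, p (a i)) * f a

section prodExpect

variable {α : Type*} {s : Finset α} {p X : α → ℝ} {n : ℕ}

theorem prodExpect_mono (hp : ∀ x ∈ s, 0 ≤ p x) {f g : (Fin n → α) → ℝ}
    (h : ∀ a, (∀ i, a i ∈ s) → f a ≤ g a) : prodExpect s p n f ≤ prodExpect s p n g := by
  refine Finset.sum_le_sum fun a ha => ?_
  rw [Fintype.mem_piFinset] at ha
  exact mul_le_mul_of_nonneg_left (h a ha) (Finset.prod_nonneg fun i _ => hp _ (ha i))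

theorem prodExpect_add (f g : (Fin n → α) → ℝ) :
    prodExpect s p n (fun a => f a + g a) = prodExpect s p n f + prodExpect s p n g := by
  simp [prodExpect, mul_add, Finset.sum_add_distrib]

theorem prodExpect_sub (f g : (Fin n → α) → ℝ) :
    prodExpect s p n (fun a => f a - g a) = prodExpect s p n f - prodExpect s p n g := by
  simp [prodExpect, mul_sub, Finset.sum_sub_distrib]

theorem prodExpect_mul_left (c : ℝ) (f : (Fin n → α) → ℝ) :
    prodExpect s p n (fun a => c * f a) = c * prodExpect s p n f := by
  simp only [prodExpect, Finset.mul_sum]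
  exact Finset.sum_congr rfl fun a _ => by ring

theorem prodExpect_one (hp1 : ∑ x ∈ s, p x = 1) : prodExpect s p n (fun _ => 1) = 1 := by
  have := Finset.prod_univ_sum (fun _ : Fin n => s) (fun _ x => p x)
  simp [prodExpect, ← this, hp1]

theorem prodExpect_exp (l : ℝ) :
    prodExpect s p n (fun a => Real.exp (l * ∑ i, X (a i))) =
      (∑ x ∈ s, p x * Real.exp (l * X x)) ^ n := by
  have := Finset.prod_univ_sum (fun _ : Fin n => s) (fun _ x => p x * Real.exp (l * X x))
  rw [Finset.prod_const, Finset.card_univ, Fintype.card_fin] at this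
  rw [this, prodExpect]
  refine Finset.sum_congr rfl fun a _ => ?_
  rw [Finset.prod_mul_distrib, Finset.mul_sum, Real.exp_sum]

/-- The characteristic function of `X` under the weights `p` on `s`. -/
noncomputable def finCharFun (s : Finset α) (p X : α → ℝ) (t : ℝ) : ℂ :=
  ∑ x ∈ s, (p x : ℂ) * Complex.exp ((t * X x : ℝ) * Complex.I)

theorem finCharFun_pow (t : ℝ) : finCharFun s p X t ^ n =
    ∑ a ∈ Fintype.piFinset fun _ : Fin n => s, ((∏ i, p (a i) : ℝ) : ℂ) *
      Complex.exp ((t * ∑ i, X (a i) : ℝ) * Complex.I) := by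
  have := Finset.prod_univ_sum (fun _ : Fin n => s)
    (fun _ x => (p x : ℂ) * Complex.exp ((t * X x : ℝ) * Complex.I))
  rw [Finset.prod_const, Finset.card_univ, Fintype.card_fin] at this
  rw [finCharFun, this]
  refine Finset.sum_congr rfl fun a _ => ?_
  rw [Finset.prod_mul_distrib, Finset.mul_sum, Complex.ofReal_sum, Finset.sum_mul, Complex.exp_sum,
    Complex.ofReal_prod]

theorem prodExpect_sin (t : ℝ) :
    prodExpect s p n (fun a => Real.sin (t * ∑ i, X (a i))) = (finCharFun s p X t ^ n).im := by
  rw [finCharFun_pow, Complex.im_sum, prodExpect]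
  refine Finset.sum_congr rfl fun a _ => ?_
  rw [Complex.im_ofReal_mul, Complex.exp_ofReal_mul_I_im]

theorem prodExpect_cos (t : ℝ) :
    prodExpect s p n (fun a => Real.cos (t * ∑ i, X (a i))) = (finCharFun s p X t ^ n).re := by
  rw [finCharFun_pow, Complex.re_sum, prodExpect]
  refine Finset.sum_congr rfl fun a _ => ?_
  rw [Complex.re_ofReal_mul, Complex.exp_ofReal_mul_I_re]

/-- Unlike the bound by ‖z‖ⁿ⁺¹, this keeps a factor |Im z|, which makes the later division by t
harmless. -/
theorem abs_im_pow_le (z : ℂ) (n : ℕ) : |(z ^ (n + 1)).im| ≤ (n + 1) * |z.im| * ‖z‖ ^ n := by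
  induction n with
  | zero => simp
  | succ n ih =>
    rw [pow_succ, Complex.mul_im]
    have h1 : |(z ^ (n + 1)).re * z.im| ≤ ‖z‖ ^ (n + 1) * |z.im| := by
      rw [abs_mul]
      have := Complex.abs_re_le_norm (z ^ (n + 1))
      rw [norm_pow] at this
      gcongr
    have h2 : |(z ^ (n + 1)).im * z.re| ≤ (n + 1) * |z.im| * ‖z‖ ^ n * ‖z‖ := by
      rw [abs_mul]
      gcongr
      exact Complex.abs_re_le_norm z
    refine (abs_add_le _ _).trans ((add_le_add h1 h2).trans (le_of_eq ?_))
    push_cast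
    ring

theorem abs_sin_sub_self_le (y : ℝ) : |Real.sin y - y| ≤ |y| ^ 3 / 6 := by
  wlog hy : 0 ≤ y generalizing y
  · have := this (-y) (by linarith)
    rwa [Real.sin_neg, abs_neg, ← neg_sub', abs_neg] at this
  rw [abs_of_nonneg hy, abs_of_nonpos (by linarith [Real.sin_le hy])]
  linarith [Real.sin_ge_sub_cube hy]

variable (hp : ∀ x ∈ s, 0 ≤ p x) (hp1 : ∑ x ∈ s, p x = 1) (hX : ∑ x ∈ s, p x * X x = 0)
  (hX1 : ∀ x ∈ s, |X x| ≤ 1)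

-- The zero mean cancels the linear term of the sine, and |X| ≤ 1 turns the cubic remainder into a
-- multiple of the variance.
include hp hX hX1 in
theorem abs_im_finCharFun_le {t : ℝ} (ht : 0 ≤ t) :
    |(finCharFun s p X t).im| ≤ t ^ 3 * (∑ x ∈ s, p x * X x ^ 2) / 6 := by
  have h : (finCharFun s p X t).im = ∑ x ∈ s, p x * (Real.sin (t * X x) - t * X x) := by
    simp only [mul_sub, Finset.sum_sub_distrib, mul_left_comm _ t, ← Finset.mul_sum, hX, mul_zero,
      sub_zero, finCharFun, Complex.im_sum, Complex.im_ofReal_mul, Complex.exp_ofReal_mul_I_im]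
  rw [h, Finset.mul_sum, Finset.sum_div]
  refine (Finset.abs_sum_le_sum_abs _ _).trans (Finset.sum_le_sum fun x hx => ?_)
  rw [abs_mul, abs_of_nonneg (hp x hx)]
  have h1 := abs_sin_sub_self_le (t * X x)
  have h2 : |t * X x| ^ 3 ≤ t ^ 3 * X x ^ 2 := by
    rw [abs_mul, abs_of_nonneg ht, mul_pow, pow_succ |X x|, sq_abs]
    gcongr
    exact mul_le_of_le_one_right (sq_nonneg _) (hX1 x hx)
  calc p x * |Real.sin (t * X x) - t * X x| ≤ p x * (t ^ 3 * X x ^ 2 / 6) :=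
        mul_le_mul_of_nonneg_left (by linarith) (hp x hx)
    _ = _ := by ring

include hp hp1 hX1 in
theorem abs_re_finCharFun_le {t : ℝ} (ht : 0 ≤ t) (ht1 : t ≤ 1) :
    |(finCharFun s p X t).re| ≤ 1 - t ^ 2 * (∑ x ∈ s, p x * X x ^ 2) / 5 := by
  have h : (finCharFun s p X t).re = ∑ x ∈ s, p x * Real.cos (t * X x) := by
    simp only [finCharFun, Complex.re_sum, Complex.re_ofReal_mul, Complex.exp_ofReal_mul_I_re]
  have hb : ∀ x ∈ s, |t * X x| ≤ 1 := fun x hx => by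
    rw [abs_mul, abs_of_nonneg ht]
    exact mul_le_one₀ ht1 (abs_nonneg _) (hX1 x hx)
  rw [h, abs_of_nonneg (Finset.sum_nonneg fun x hx =>
    mul_nonneg (hp x hx) (Real.cos_pos_of_le_one (hb x hx)).le), ← hp1, Finset.mul_sum,
    Finset.sum_div, ← Finset.sum_sub_distrib]
  refine Finset.sum_le_sum fun x hx => ?_
  have h1 := Real.cos_le_one_sub_mul_cos_sq (x := t * X x)
    ((hb x hx).trans (by linarith [Real.pi_gt_three]))
  have h2 : 1 / 5 ≤ 2 / Real.pi ^ 2 := by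
    rw [div_le_div_iff₀ (by norm_num) (by positivity)]
    nlinarith [Real.pi_lt_d2, Real.pi_pos]
  have h3 : Real.cos (t * X x) ≤ 1 - 1 / 5 * (t * X x) ^ 2 := by nlinarith [sq_nonneg (t * X x)]
  calc p x * Real.cos (t * X x) ≤ p x * (1 - 1 / 5 * (t * X x) ^ 2) :=
        mul_le_mul_of_nonneg_left h3 (hp x hx)
    _ = _ := by ring

-- The real part loses t²v/5 and the imaginary part restores at most t³v/6 ≤ t²v/6; the constant is
-- 1/5 − 1/6 = 1/30.
include hp hp1 hX hX1 in
theorem norm_finCharFun_le {t : ℝ} (ht : 0 ≤ t) (ht1 : t ≤ 1) :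
    ‖finCharFun s p X t‖ ≤ Real.exp (-(t ^ 2 * (∑ x ∈ s, p x * X x ^ 2) / 30)) := by
  have h1 := Complex.norm_le_abs_re_add_abs_im (finCharFun s p X t)
  have h2 := abs_im_finCharFun_le hp hX hX1 ht
  have h3 := abs_re_finCharFun_le hp hp1 hX1 ht ht1
  have hv : 0 ≤ ∑ x ∈ s, p x * X x ^ 2 :=
    Finset.sum_nonneg fun x hx => mul_nonneg (hp x hx) (sq_nonneg _)
  have h4 := Real.add_one_le_exp (-(t ^ 2 * (∑ x ∈ s, p x * X x ^ 2) / 30))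
  have h5 : t ^ 3 * (∑ x ∈ s, p x * X x ^ 2) ≤ t ^ 2 * (∑ x ∈ s, p x * X x ^ 2) :=
    mul_le_mul_of_nonneg_right (pow_le_pow_of_le_one ht ht1 (by norm_num)) hv
  linarith

include hp hp1 hX hX1 in
theorem prodExpect_cos_le {t : ℝ} (ht : 0 ≤ t) (ht1 : t ≤ 1) :
    prodExpect s p n (fun a => Real.cos (t * ∑ i, X (a i))) ≤
      Real.exp (-(n * (∑ x ∈ s, p x * X x ^ 2) / 60) * t ^ 2) := by
  rw [prodExpect_cos]
  refine (Complex.re_le_norm _).trans ?_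
  rw [norm_pow]
  refine (pow_le_pow_left₀ (norm_nonneg _) (norm_finCharFun_le hp hp1 hX hX1 ht ht1) n).trans ?_
  rw [← Real.exp_nat_mul]
  have hv : 0 ≤ ∑ x ∈ s, p x * X x ^ 2 :=
    Finset.sum_nonneg fun x hx => mul_nonneg (hp x hx) (sq_nonneg _)
  have : 0 ≤ n * (∑ x ∈ s, p x * X x ^ 2) * t ^ 2 := by positivity
  -- The rate 1/30 is relaxed to 1/60 so that the cosine and sine bounds share one Gaussian.
  exact Real.exp_le_exp.2 (by linarith)

-- The power of |φ| supplies e^(−2u) up to a constant, with u of order nvt². One factor e^(−u)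
-- absorbs the u produced by n·|Im φ|; the other remains as the Gaussian.
include hp hp1 hX hX1 in
theorem abs_prodExpect_sin_le {t : ℝ} (ht : 0 ≤ t) (ht1 : t ≤ 1) :
    |prodExpect s p n (fun a => Real.sin (t * ∑ i, X (a i)))| ≤
      60 * Real.exp (-(n * (∑ x ∈ s, p x * X x ^ 2) / 60) * t ^ 2) * t := by
  rw [prodExpect_sin]
  rcases n with _ | n
  · simp only [pow_zero, Complex.one_im, abs_zero]
    positivity
  refine (abs_im_pow_le _ _).trans ?_
  have h2 := abs_im_finCharFun_le hp hX hX1 ht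
  have h3 := pow_le_pow_left₀ (norm_nonneg _) (norm_finCharFun_le hp hp1 hX hX1 ht ht1) n
  have hv1 : ∑ x ∈ s, p x * X x ^ 2 ≤ 1 := by
    rw [← hp1]
    exact Finset.sum_le_sum fun x hx =>
      mul_le_of_le_one_right (hp x hx) ((sq_le_one_iff_abs_le_one _).2 (hX1 x hx))
  have hv : 0 ≤ ∑ x ∈ s, p x * X x ^ 2 :=
    Finset.sum_nonneg fun x hx => mul_nonneg (hp x hx) (sq_nonneg _)
  set v := ∑ x ∈ s, p x * X x ^ 2
  rw [← Real.exp_nat_mul] at h3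
  set u := (n + 1 : ℝ) * v * t ^ 2 / 60 with hu
  have h4 : Real.exp (n * -(t ^ 2 * v / 30)) = Real.exp (t ^ 2 * v / 30) *
      (Real.exp (-u) * Real.exp (-u)) := by
    rw [← Real.exp_add, ← Real.exp_add]
    congr 1
    rw [hu]
    ring
  -- This factor pays for having n rather than n + 1 powers of |φ|; the crude bound 6 cancels the
  -- 1/6 from the imaginary part.
  have h5 : Real.exp (t ^ 2 * v / 30) ≤ 6 := by
    have : t ^ 2 * v ≤ 1 := mul_le_one₀ (pow_le_one₀ ht ht1) hv hv1
    refine (Real.exp_le_exp.2 (by linarith : _ ≤ (1 : ℝ))).trans ?_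
    linarith [Real.exp_one_lt_d9]
  have h6 : u * Real.exp (-u) ≤ 1 := by
    have := Real.add_one_le_exp u
    rw [Real.exp_neg, ← div_eq_mul_inv, div_le_one (Real.exp_pos _)]
    linarith
  rw [h4] at h3
  have h7 : -(((n + 1 : ℕ) : ℝ) * v / 60) * t ^ 2 = -u := by
    rw [hu]; push_cast; ring
  rw [h7]
  have hu0 : 0 ≤ u := by positivity
  calc (n + 1 : ℝ) * |(finCharFun s p X t).im| * ‖finCharFun s p X t‖ ^ n
      ≤ (n + 1 : ℝ) * (t ^ 3 * v / 6) * (6 * (Real.exp (-u) * Real.exp (-u))) := by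
        gcongr
        exact h3.trans (by gcongr)
    _ = 60 * Real.exp (-u) * t * (u * Real.exp (-u)) := by rw [hu]; ring
    _ ≤ 60 * Real.exp (-u) * t := mul_le_of_le_one_right (by positivity) h6

/-! ### Integration over frequencies and the Berry–Esseen bound -/

theorem integral_exp_neg_mul_sq_le {b : ℝ} (hb : 0 < b) :
    ∫ t in (0 : ℝ)..1, Real.exp (-b * t ^ 2) ≤ √(Real.pi / b) / 2 := by
  rw [← integral_gaussian_Ioi, intervalIntegral.integral_of_le zero_le_one]
  exact setIntegral_mono_set (integrable_exp_neg_mul_sq hb).integrableOn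
    (Eventually.of_forall fun t => (Real.exp_pos _).le)
    (Ioc_subset_Ioi_self : Ioc (0 : ℝ) 1 ⊆ Ioi 0).eventuallyLE

theorem prodExpect_integral {f : ℝ → (Fin n → α) → ℝ}
    (hf : ∀ a, IntervalIntegrable (fun t => f t a) volume 0 1) :
    prodExpect s p n (fun a => ∫ t in (0 : ℝ)..1, f t a) =
      ∫ t in (0 : ℝ)..1, prodExpect s p n (f t) := by
  simp only [prodExpect]
  rw [intervalIntegral.integral_finsetSum fun a _ => (hf a).const_mul _]
  simp only [intervalIntegral.integral_const_mul]

theorem intervalIntegrable_prodExpect {f : ℝ → (Fin n → α) → ℝ}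
    (hf : ∀ a, IntervalIntegrable (fun t => f t a) volume 0 1) :
    IntervalIntegrable (fun t => prodExpect s p n (f t)) volume 0 1 := by
  have := IntervalIntegrable.sum (Fintype.piFinset fun _ : Fin n => s)
    (f := fun a t => (∏ i, p (a i)) * f t a) (fun a _ => (hf a).const_mul _)
  refine this.congr ?_
  exact fun t _ => by simp [prodExpect]

include hp hp1 hX hX1 in
theorem prodExpect_bumpKernel_le (hv : 0 < ∑ x ∈ s, p x * X x ^ 2) (hn : 0 < n) :
    prodExpect s p n (fun a => bumpKernel (∑ i, X (a i))) ≤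
      √(Real.pi / (n * (∑ x ∈ s, p x * X x ^ 2) / 60)) / 2 := by
  have hb : 0 < n * (∑ x ∈ s, p x * X x ^ 2) / 60 := by positivity
  have hi : ∀ a : Fin n → α, IntervalIntegrable
      (fun t : ℝ => (1 - t) ^ 2 * Real.cos (t * ∑ i, X (a i))) volume 0 1 :=
    fun a => (by fun_prop : Continuous _).intervalIntegrable _ _
  simp only [bumpKernel]
  rw [prodExpect_integral hi]
  refine le_trans ?_ (integral_exp_neg_mul_sq_le hb)
  refine intervalIntegral.integral_mono_on zero_le_one (intervalIntegrable_prodExpect hi)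
    ((by fun_prop : Continuous _).intervalIntegrable _ _) fun t ht => ?_
  rw [prodExpect_mul_left]
  have h1 := prodExpect_cos_le (n := n) hp hp1 hX hX1 ht.1 ht.2
  have h2 : (1 - t) ^ 2 ≤ 1 := pow_le_one₀ (by linarith [ht.2]) (by linarith [ht.1])
  nlinarith [sq_nonneg (1 - t), Real.exp_pos (-(n * (∑ x ∈ s, p x * X x ^ 2) / 60) * t ^ 2)]

include hp hp1 hX hX1 in
theorem prodExpect_signKernel_le (hv : 0 < ∑ x ∈ s, p x * X x ^ 2) (hn : 0 < n) :
    prodExpect s p n (fun a => signKernel (∑ i, X (a i))) ≤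
      240 * (√(Real.pi / (n * (∑ x ∈ s, p x * X x ^ 2) / 60)) / 2) := by
  have hb : 0 < n * (∑ x ∈ s, p x * X x ^ 2) / 60 := by positivity
  have hi := fun a : Fin n → α => intervalIntegrable_signKernel (∑ i, X (a i))
  simp only [signKernel]
  rw [prodExpect_integral hi]
  refine le_trans ?_ (mul_le_mul_of_nonneg_left (integral_exp_neg_mul_sq_le hb) (by norm_num))
  rw [← intervalIntegral.integral_const_mul]
  refine intervalIntegral.integral_mono_on zero_le_one (intervalIntegrable_prodExpect hi)
    ((by fun_prop : Continuous _).intervalIntegrable _ _) fun t ht => ?_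
  simp only [div_eq_inv_mul (Real.sin _) t]
  rw [prodExpect_mul_left, prodExpect_mul_left]
  have h1 := (le_abs_self _).trans (abs_prodExpect_sin_le (n := n) hp hp1 hX hX1 ht.1 ht.2)
  have h0 : 0 ≤ (1 - t) ^ 3 := pow_nonneg (by linarith [ht.2]) _
  have h2 : (1 - t) ^ 3 ≤ 1 := pow_le_one₀ (by linarith [ht.2]) (by linarith [ht.1])
  have h3 : (1 - t) ^ 3 * (1 + 3 * t) ≤ 4 := by nlinarith [ht.1, ht.2]
  have h4 : 0 ≤ (1 - t) ^ 3 * (1 + 3 * t) := mul_nonneg h0 (by linarith [ht.1])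
  have h5 : t⁻¹ * prodExpect s p n (fun a => Real.sin (t * ∑ i, X (a i))) ≤
      60 * Real.exp (-(n * (∑ x ∈ s, p x * X x ^ 2) / 60) * t ^ 2) := by
    -- At t = 0 the inverse is 0 by convention, so the left side vanishes.
    rcases ht.1.eq_or_lt with rfl | h
    · simp
    · rw [inv_mul_le_iff₀ h]
      linarith
  have h6 := Real.exp_pos (-(n * (∑ x ∈ s, p x * X x ^ 2) / 60) * t ^ 2)
  calc _ ≤ (1 - t) ^ 3 * (1 + 3 * t) *
        (60 * Real.exp (-(n * (∑ x ∈ s, p x * X x ^ 2) / 60) * t ^ 2)) :=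
        mul_le_mul_of_nonneg_left h5 h4
    _ ≤ 4 * (60 * Real.exp (-(n * (∑ x ∈ s, p x * X x ^ 2) / 60) * t ^ 2)) :=
        mul_le_mul_of_nonneg_right h3 (by positivity)
    _ = _ := by ring

include hp hp1 hX hX1 in
/-- A one-sided Berry–Esseen bound at the mean, for variables bounded by one. -/
theorem exists_prodExpect_sign_le_of_le_one (hv : 0 < ∑ x ∈ s, p x * X x ^ 2) :
    ∃ K : ℝ, 0 ≤ K ∧ ∀ n : ℕ, 0 < n →
      prodExpect s p n (fun a => (SignType.sign (∑ i, X (a i)) : ℝ)) ≤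
        K * (n : ℝ) ^ (-(1 / 2) : ℝ) := by
  obtain ⟨L, B, hL, hB, h⟩ := exists_sign_le_kernel
  refine ⟨(240 + B) * √(Real.pi * 60 / ∑ x ∈ s, p x * X x ^ 2) / 2 / L, by positivity,
    fun n hn => ?_⟩
  have h1 := prodExpect_mono (n := n) hp fun a _ => h (∑ i, X (a i))
  rw [prodExpect_mul_left, prodExpect_add, prodExpect_mul_left] at h1
  have h2 := prodExpect_signKernel_le hp hp1 hX hX1 hv hn
  have h3 := mul_le_mul_of_nonneg_left (prodExpect_bumpKernel_le hp hp1 hX hX1 hv hn) hB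
  have hn' : (0 : ℝ) < n := Nat.cast_pos.2 hn
  have h4 : √(Real.pi / (n * (∑ x ∈ s, p x * X x ^ 2) / 60)) =
      √(Real.pi * 60 / ∑ x ∈ s, p x * X x ^ 2) * (n : ℝ) ^ (-(1 / 2) : ℝ) := by
    rw [Real.rpow_neg hn'.le, ← Real.sqrt_eq_rpow, ← Real.sqrt_inv, ← Real.sqrt_mul (by positivity)]
    congr 1
    field_simp
  rw [h4] at h2 h3
  rw [div_mul_eq_mul_div, le_div_iff₀ hL]
  linarith

include hp hp1 hX in
/-- A one-sided Berry–Esseen bound at the mean. -/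
theorem exists_prodExpect_sign_le : ∃ K : ℝ, 0 ≤ K ∧ ∀ n : ℕ, 0 < n →
      prodExpect s p n (fun a => (SignType.sign (∑ i, X (a i)) : ℝ)) ≤
        K * (n : ℝ) ^ (-(1 / 2) : ℝ) := by
  obtain ⟨M, hM, hM0⟩ : ∃ M, (∀ x ∈ s, |X x| ≤ M) ∧ 0 < M := by
    refine ⟨∑ x ∈ s, |X x| + 1, fun x hx => ?_, by positivity⟩
    linarith [Finset.single_le_sum (fun y _ => abs_nonneg (X y)) hx]
  have hterm : ∀ x ∈ s, 0 ≤ p x * X x ^ 2 := fun x hx => mul_nonneg (hp x hx) (sq_nonneg _)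
  rcases (Finset.sum_nonneg hterm).eq_or_lt with hv | hv
  -- Zero variance: X vanishes wherever p does not, so each tuple has sum 0 or weight 0.
  · refine ⟨0, le_rfl, fun n _ => ?_⟩
    rw [eq_comm, Finset.sum_eq_zero_iff_of_nonneg hterm] at hv
    rw [zero_mul]
    refine Finset.sum_nonpos fun a ha => ?_
    rw [Fintype.mem_piFinset] at ha
    by_cases h : ∀ i, X (a i) = 0
    · simp [h]
    · push Not at h
      obtain ⟨i, hi⟩ := h
      have : p (a i) = 0 := by simpa [hi] using hv _ (ha i)
      rw [Finset.prod_eq_zero (Finset.mem_univ i) this, zero_mul]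
  · obtain ⟨K, hK, h⟩ := exists_prodExpect_sign_le_of_le_one (X := fun x => X x / M) hp hp1
      (by simp only [← mul_div_assoc, ← Finset.sum_div, hX, zero_div])
      (fun x hx => by
        rw [abs_div, abs_of_pos hM0, div_le_one hM0]
        exact hM x hx)
      (by simp only [div_pow, ← mul_div_assoc, ← Finset.sum_div]; positivity)
    refine ⟨K, hK, fun n hn => ?_⟩
    have := h n hn
    simpa only [div_eq_mul_inv, ← Finset.sum_mul, sign_mul, sign_pos (inv_pos.2 hM0), mul_one]
      using this

/-! ### Hoeffding's inequality -/

include hp hp1 hX in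
/-- Hoeffding's lemma for a bounded centred variable with finitely many values. -/
theorem sum_mul_exp_le {M : ℝ} (hM0 : 0 < M) (hM : ∀ x ∈ s, |X x| ≤ M) (l : ℝ) :
    ∑ x ∈ s, p x * Real.exp (l * X x) ≤ Real.exp ((l * M) ^ 2 / 2) := by
  refine le_trans ?_ (Real.cosh_le_exp_half_sq (l * M))
  -- Convexity bounds exp by its chord over [−lM, lM]; the linear part of the chord averages to
  -- zero.
  have key : ∀ x ∈ s, p x * Real.exp (l * X x) ≤
      p x * Real.cosh (l * M) + p x * X x * (Real.sinh (l * M) / M) := fun x hx => by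
    have hx' := abs_le.1 (hM x hx)
    have h0 : 0 ≤ (1 + X x / M) / 2 := by
      have : -1 ≤ X x / M := by rw [le_div_iff₀ hM0]; linarith
      linarith
    have h1 : 0 ≤ (1 - X x / M) / 2 := by
      have : X x / M ≤ 1 := by rw [div_le_one hM0]; linarith
      linarith
    have h := convexOn_exp.2 (mem_univ (l * M)) (mem_univ (-(l * M))) h0 h1 (by ring)
    simp only [smul_eq_mul] at h
    have e : (1 + X x / M) / 2 * (l * M) + (1 - X x / M) / 2 * -(l * M) = l * X x := by
      field_simp; ring
    rw [e] at h
    have := mul_le_mul_of_nonneg_left h (hp x hx)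
    refine this.trans (le_of_eq ?_)
    rw [Real.cosh_eq, Real.sinh_eq]
    ring
  refine (Finset.sum_le_sum key).trans (le_of_eq ?_)
  rw [Finset.sum_add_distrib, ← Finset.sum_mul, ← Finset.sum_mul, hp1, hX]
  ring

include hp hp1 hX in
/-- Hoeffding's inequality, for the lower bound of the probability of the complementary event. -/
theorem one_sub_exp_le_prodExpect {M : ℝ} (hM0 : 0 < M) (hM : ∀ x ∈ s, |X x| ≤ M)
    {δ : ℝ} (hδ : 0 ≤ δ) :
    1 - Real.exp (-(n * δ ^ 2 / (2 * M ^ 2))) ≤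
      prodExpect s p n ({a | ∑ i, X (a i) ≤ δ * n}.indicator 1) := by
  -- This l minimises the Chernoff exponent −lδn + n(lM)²/2.
  set l := δ / M ^ 2 with hl
  have h : ∀ a : Fin n → α, 1 - Real.exp (-(l * (δ * n))) * Real.exp (l * ∑ i, X (a i)) ≤
      ({a | ∑ i, X (a i) ≤ δ * n} : Set (Fin n → α)).indicator (1 : (Fin n → α) → ℝ) a := fun a => by
    rw [← Real.exp_add]
    by_cases ha : ∑ i, X (a i) ≤ δ * n
    · rw [indicator_of_mem (by exact ha), Pi.one_apply]
      linarith [Real.exp_pos (-(l * (δ * n)) + l * ∑ i, X (a i))]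
    · rw [indicator_of_notMem (by exact ha), sub_nonpos]
      refine Real.one_le_exp ?_
      rw [not_le] at ha
      nlinarith [mul_nonneg (by positivity : 0 ≤ l) (sub_nonneg.2 ha.le)]
  refine le_trans ?_ (prodExpect_mono hp fun a _ => h a)
  rw [prodExpect_sub, prodExpect_one hp1, prodExpect_mul_left, prodExpect_exp]
  have h1 := pow_le_pow_left₀ (Finset.sum_nonneg fun x hx =>
    mul_nonneg (hp x hx) (Real.exp_pos _).le) (sum_mul_exp_le hp hp1 hX hM0 hM l) n
  rw [← Real.exp_nat_mul] at h1
  have h2 := mul_le_mul_of_nonneg_left h1 (Real.exp_pos (-(l * (δ * n)))).le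
  rw [← Real.exp_add] at h2
  have e : -(l * (δ * n)) + n * ((l * M) ^ 2 / 2) = -(n * δ ^ 2 / (2 * M ^ 2)) := by
    rw [hl]; field_simp; ring
  rw [e] at h2
  linarith

end prodExpect

/-! ### Transfer to core sets -/

theorem sum_toReal_support {α : Type*} (χ : PMF α) (hχ : χ.support.Finite) :
    ∑ x ∈ hχ.toFinset, (χ x).toReal = 1 := by
  have h : ∑ x ∈ hχ.toFinset, χ x = 1 := by
    rw [← χ.tsum_coe, tsum_eq_sum (s := hχ.toFinset)
      fun x hx => (χ.apply_eq_zero_iff x).2 (by simpa using hx)]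
  rw [← ENNReal.toReal_sum fun x _ => χ.apply_ne_top x, h, ENNReal.toReal_one]

theorem prodDist_toReal {α : Type*} (χ : PMF α) (n : ℕ) (a : Fin n → α) :
    (prodDist χ n a).toReal = ∏ i, (χ (a i)).toReal := by
  rw [← ENNReal.toReal_prod]
  rfl

theorem shannonEntropy_eq_sum {α : Type*} (χ : PMF α) (hχ : χ.support.Finite) :
    shannonEntropy χ = -∑ x ∈ hχ.toFinset, (χ x).toReal * Real.logb 2 (χ x).toReal := by
  rw [shannonEntropy, ← Finset.tsum_subtype hχ.toFinset
    fun x => (χ x).toReal * Real.logb 2 (χ x).toReal]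
  congr 1
  exact (Equiv.setCongr (by ext; simp : χ.support = {x | x ∈ hχ.toFinset})).tsum_eq
    fun x : {x | x ∈ hχ.toFinset} => (χ x).toReal * Real.logb 2 (χ x).toReal

/-- The centred self-information of `χ`, in bits. -/
noncomputable def centredInfo {α : Type*} (χ : PMF α) (x : α) : ℝ :=
  -Real.logb 2 (χ x).toReal - shannonEntropy χ

theorem sum_mul_centredInfo {α : Type*} (χ : PMF α) (hχ : χ.support.Finite) :
    ∑ x ∈ hχ.toFinset, (χ x).toReal * centredInfo χ x = 0 := by
  simp only [centredInfo, mul_sub, Finset.sum_sub_distrib, ← Finset.sum_mul,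
    sum_toReal_support χ hχ, mul_neg, Finset.sum_neg_distrib]
  rw [shannonEntropy_eq_sum χ hχ]
  ring

theorem prob_prodDist {α : Type*} (χ : PMF α) (hχ : χ.support.Finite) (n : ℕ)
    (S : Set (Fin n → α)) :
    prob (prodDist χ n) S =
      prodExpect hχ.toFinset (fun x => (χ x).toReal) n (S.indicator 1) := by
  have h0 : ∀ a ∉ Fintype.piFinset fun _ : Fin n => hχ.toFinset,
      S.indicator (prodDist χ n) a = 0 := fun a ha => by
    simp only [Fintype.mem_piFinset, Finite.mem_toFinset, PMF.mem_support_iff, not_forall,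
      not_not] at ha
    obtain ⟨i, hi⟩ := ha
    exact indicator_apply_eq_zero.2 fun _ => Finset.prod_eq_zero (Finset.mem_univ i) hi
  rw [prob, PMF.toOuterMeasure_apply, tsum_eq_sum h0, ENNReal.toReal_sum, prodExpect]
  · refine Finset.sum_congr rfl fun a _ => ?_
    by_cases ha : a ∈ S
    · rw [indicator_of_mem ha, indicator_of_mem ha, Pi.one_apply, mul_one]
      exact prodDist_toReal χ n a
    · rw [indicator_of_notMem ha, indicator_of_notMem ha]
      simp
  · intro a _
    by_cases ha : a ∈ S
    · rw [indicator_of_mem ha]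
      exact PMF.apply_ne_top _ _
    · rw [indicator_of_notMem ha]
      exact ENNReal.zero_ne_top

theorem mem_coreSet_of_sum_le {α : Type*} (χ : PMF α) {n : ℕ} {δ : ℝ}
    {a : Fin n → α} (ha : ∀ i, a i ∈ χ.support) (h : ∑ i, centredInfo χ (a i) ≤ δ * n) :
    a ∈ coreSet χ n δ := by
  have hpos : ∀ i, 0 < (χ (a i)).toReal := fun i =>
    ENNReal.toReal_pos ((χ.mem_support_iff _).1 (ha i)) (χ.apply_ne_top _)
  refine ⟨ha, ?_⟩
  have e : (prodDist χ n a).toReal = (2 : ℝ) ^ ∑ i, Real.logb 2 (χ (a i)).toReal := by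
    rw [Real.rpow_sum_of_pos two_pos]
    refine (prodDist_toReal χ n a).trans (Finset.prod_congr rfl fun i _ => ?_)
    rw [Real.rpow_logb two_pos (by norm_num) (hpos i)]
  rw [e]
  refine Real.rpow_le_rpow_of_exponent_le one_le_two ?_
  simp only [centredInfo, Finset.sum_sub_distrib, Finset.sum_neg_distrib, Finset.sum_const,
    Finset.card_univ, Fintype.card_fin, nsmul_eq_mul] at h
  linarith

theorem prodExpect_indicator_le_prob_coreSet {α : Type*} (χ : PMF α) (hχ : χ.support.Finite)
    (n : ℕ) (δ : ℝ) :
    prodExpect hχ.toFinset (fun x => (χ x).toReal) n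
      ({a | ∑ i, centredInfo χ (a i) ≤ δ * n}.indicator 1) ≤
        prob (prodDist χ n) (coreSet χ n δ) := by
  rw [prob_prodDist χ hχ]
  refine prodExpect_mono (fun x _ => ENNReal.toReal_nonneg) fun a ha => ?_
  by_cases h : ∑ i, centredInfo χ (a i) ≤ δ * n
  · rw [indicator_of_mem (by exact h), indicator_of_mem
      (mem_coreSet_of_sum_le χ (fun i => by simpa using ha i) h)]
  · rw [indicator_of_notMem (by exact h)]
    exact indicator_nonneg (fun _ _ => zero_le_one) _

theorem exists_half_sub_le_prob_coreSet {α : Type*} (χ : PMF α) (hχ : χ.support.Finite) :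
    ∃ K : ℝ, 0 ≤ K ∧ ∀ δ : ℝ, 0 ≤ δ → ∀ n : ℕ, 0 < n →
      1 / 2 - K * (n : ℝ) ^ (-(1 / 2) : ℝ) ≤ prob (prodDist χ n) (coreSet χ n δ) := by
  have hp : ∀ x ∈ hχ.toFinset, 0 ≤ (χ x).toReal := fun x _ => ENNReal.toReal_nonneg
  obtain ⟨K, hK, h⟩ := exists_prodExpect_sign_le hp (sum_toReal_support χ hχ)
    (sum_mul_centredInfo χ hχ)
  refine ⟨K / 2, by positivity, fun δ hδ n hn => ?_⟩
  refine le_trans ?_ (prodExpect_indicator_le_prob_coreSet χ hχ n δ)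
  -- The left side is 1, 1/2 or 0 as the sum is negative, zero or positive, so the event "sum ≤ 0"
  -- already suffices for every δ ≥ 0.
  have h1 : ∀ a : Fin n → α,
      1 - 1 / 2 * (1 + (SignType.sign (∑ i, centredInfo χ (a i)) : ℝ)) ≤
      ({a | ∑ i, centredInfo χ (a i) ≤ δ * n} : Set (Fin n → α)).indicator
        (1 : (Fin n → α) → ℝ) a := fun a => by
    rcases le_or_gt (∑ i, centredInfo χ (a i)) 0 with h0 | h0
    · rw [indicator_of_mem (by exact h0.trans (by positivity)), Pi.one_apply]
      rcases h0.lt_or_eq with h0 | h0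
      · simp [sign_neg h0]
      · rw [h0]; simp
    · rw [sign_pos h0]
      refine le_trans (by norm_num) (indicator_nonneg (fun _ _ => zero_le_one) _)
  refine le_trans ?_ (prodExpect_mono hp fun a _ => h1 a)
  rw [prodExpect_sub, prodExpect_mul_left, prodExpect_add,
    prodExpect_one (sum_toReal_support χ hχ)]
  linarith [h n hn]

theorem exists_one_sub_le_prob_coreSet {α : Type*} (χ : PMF α) (hχ : χ.support.Finite) :
    ∃ c : ℝ, 0 < c ∧ ∀ ε : ℝ, 0 < ε → ε < 1 → ∀ n : ℕ, 0 < n →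
      1 - ε ≤ prob (prodDist χ n) (coreSet χ n (c * √(Real.log ε⁻¹ / n))) := by
  obtain ⟨M, hM, hM0⟩ : ∃ M, (∀ x ∈ hχ.toFinset, |centredInfo χ x| ≤ M) ∧ 0 < M := by
    refine ⟨∑ x ∈ hχ.toFinset, |centredInfo χ x| + 1, fun x hx => ?_, by positivity⟩
    linarith [Finset.single_le_sum (fun y _ => abs_nonneg (centredInfo χ y)) hx]
  -- With the factor √2·M the Hoeffding exponent nδ²/(2M²) is exactly log ε⁻¹.
  refine ⟨√2 * M, by positivity, fun ε hε hε1 n hn => ?_⟩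
  refine le_trans ?_ ((one_sub_exp_le_prodExpect (fun x _ => ENNReal.toReal_nonneg)
    (sum_toReal_support χ hχ) (sum_mul_centredInfo χ hχ) hM0 hM (by positivity)).trans
    (prodExpect_indicator_le_prob_coreSet χ hχ n _))
  have hn' : (0 : ℝ) < n := Nat.cast_pos.2 hn
  have hlog : 0 ≤ Real.log ε⁻¹ := Real.log_nonneg ((one_le_inv₀ hε).2 hε1.le)
  have e : n * (√2 * M * √(Real.log ε⁻¹ / n)) ^ 2 / (2 * M ^ 2) = Real.log ε⁻¹ := by
    rw [mul_pow, mul_pow, Real.sq_sqrt (by norm_num), Real.sq_sqrt (by positivity)]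
    field_simp
  rw [e, Real.log_inv, neg_neg, Real.exp_log hε]

theorem mainTheorem6 {α : Type*} (χ : PMF α) (hχ : χ.support.Finite) :
    (∃ K : ℝ, 0 ≤ K ∧ ∀ δ : ℝ, 0 ≤ δ → ∀ n : ℕ, 0 < n →
      1 / 2 - K * (n : ℝ) ^ (-(1 / 2) : ℝ) ≤ prob (prodDist χ n) (coreSet χ n δ)) ∧
    (∃ c₁ c₂ : ℝ, 0 < c₁ ∧ 0 < c₂ ∧ ∀ ε : ℝ, 0 < ε → ε < 1 → ∀ n : ℕ, 0 < n →
      ∃ δ : ℝ, 0 ≤ δ ∧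
        c₁ * Real.sqrt (Real.log ε⁻¹ / (n : ℝ)) ≤ δ ∧
        δ ≤ c₂ * Real.sqrt (Real.log ε⁻¹ / (n : ℝ)) ∧
        1 - ε ≤ prob (prodDist χ n) (coreSet χ n δ)) := by
  refine ⟨exists_half_sub_le_prob_coreSet χ hχ, ?_⟩
  obtain ⟨c, hc, h⟩ := exists_one_sub_le_prob_coreSet χ hχ
  -- δ is an exact multiple of the square root, so one constant gives both bounds.
  exact ⟨c, c, hc, hc, fun ε hε hε1 n hn =>
    ⟨_, by positivity, le_rfl, le_rfl, h ε hε hε1 n hn⟩⟩
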